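/- **Theorem.** A *full grammar* $(S',G)$ over an alphabet of size $\sigma$ consists of a starting string $S'$ and, for each of finitely many nonterminals $X$, one rule $X\to \mathrm{rhs}(X)$, where $S'$ and all $\mathrm{rhs}(X)$ are strings of letters and nonterminals and the nonterminals are linearly ordered so that $\mathrm{rhs}(X)$ contains only nonterminals smaller than $X$. The expansion of $X$ is the string over the alphabet that it derives, and $(S',G)$ generates the string derived from $S'$. Write $|G|_N$ for the number of nonterminals and $S_G$ for the concatenation of $S'$ and all $\mathrm{rhs}(X)$. The full grammar is *irreducible* if (1) no two nonterminals have the same expansion; (2) every nonterminal occurs at least twice in $S_G$; (3) no pair of consecutive symbols has two non-overlapping occurrences in the right-hand sides $S'$, $\mathrm{rhs}(X)$ (two occurrences in different right-hand sides are non-overlapping). Its *fully naive encoding* consists of the lengths of all right-hand sides in unary, followed by $S_G$ with each symbol (letter or nonterminal) written with a code of the same length $\lceil\log(\sigma+|G|_N)\rceil$. For a string $w$ let $$H_k(w) = -\frac1{|w|}\sum_{|v|=k,\ a\text{ letter}} |w|_{va}\log\frac{|w|_{va}}{|w|_v},$$ where $|w|_v$ is the number of (possibly overlapping) occurrences of $v$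 in $w$, $|w|_\epsilon=|w|$, and summands with $|w|_{va}=0$ are $0$. All logarithms without a base are binary. Let $S$ be a string of length $n$ over an alphabet of size $\sigma$ with $2\le\sigma\le n$ and let $k=o(\log_\sigma n)$. Then the fully naive encoding of any irreducible full grammar generating $S$ has at most $6|S|H_k(S)+o(|S|\log\sigma)$ bits, uniformly in all the data. That is: for every $\varepsilon>0$ there are $\delta>0$ and $n_0$ such that for all $n\ge n_0$, all $\sigma$ with $2\le\sigma\le n$, all integers $0\le k\le\delta\log_\sigma n$, every string $S$ of length $n$ over an alphabet of size $\sigma$, and every irreducible full grammar generating $S$, its fully naive encoding has at most $6nH_k(S)+\varepsilon\, n\log\sigma$ bits. -/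

import Mathlib

/-- `|w|_v`: the number of (possibly overlapping) occurrences of `v` as a subword of `w`.
For the empty word `v` this is `|w|`. -/
def occurrences {α : Type*} [DecidableEq α] (v w : List α) : ℕ :=
  ((Finset.range w.length).filter (fun i => v <+: w.drop i)).card

/-- The `k`-order empirical entropy (binary logarithm)
`H_k(w) = -(1/|w|) ∑_{|v| = k, a} |w|_{va} log (|w|_{va} / |w|_v)`.
A summand with `|w|_{va} = 0` vanishes. -/
noncomputable def empiricalEntropy {α : Type*} [Fintype α] [DecidableEq α]
    (k : ℕ) (w : List α) : ℝ :=
  -(1 / (w.length : ℝ)) * ∑ v : Fin k → α, ∑ a : α,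
    (occurrences (List.ofFn v ++ [a]) w : ℝ) *
      Real.logb 2 ((occurrences (List.ofFn v ++ [a]) w : ℝ) / (occurrences (List.ofFn v) w : ℝ))

/-- A full grammar `(S', G)` over the alphabet `Fin σ`: a starting string `S'` and one rule for each
of the `numNonterminals` nonterminals. Symbols are letters (`Sum.inl`) or nonterminals (`Sum.inr`).
Nonterminals are numbered so that a right-hand side uses only earlier nonterminals; such a numbering
exists exactly when the grammar is acyclic, that is, when every nonterminal has an expansion. -/
structure FullGrammar (σ : ℕ) where
  numNonterminals : ℕ
  start : List (Fin σ ⊕ Fin numNonterminals)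
  rule : Fin numNonterminals → List (Fin σ ⊕ Fin numNonterminals)
  acyclic : ∀ X Y : Fin numNonterminals, Sum.inr Y ∈ rule X → Y < X

namespace FullGrammar

variable {σ : ℕ}

/-- Letters and nonterminals. -/
abbrev Sym (G : FullGrammar σ) : Type := Fin σ ⊕ Fin G.numNonterminals

/-- The expansion of a nonterminal: the string over the alphabet that it generates. -/
def expansion (G : FullGrammar σ) (X : Fin G.numNonterminals) : List (Fin σ) :=
  (G.rule X).attach.flatMap fun s =>
    match s with
    | ⟨Sum.inl a, _⟩ => [a]
    | ⟨Sum.inr Y, _⟩ => G.expansion Y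
termination_by X.val
decreasing_by
  have h := G.acyclic X Y (by assumption)
  exact h

/-- The string generated by a single symbol. -/
def expandSym (G : FullGrammar σ) : G.Sym → List (Fin σ)
  | Sum.inl a => [a]
  | Sum.inr Y => G.expansion Y

theorem expansion_eq (G : FullGrammar σ) (X : Fin G.numNonterminals) :
    G.expansion X = (G.rule X).flatMap G.expandSym := by
  rw [expansion]
  conv_rhs => rw [← List.attach_map_subtype_val (G.rule X)]
  rw [List.flatMap_map]
  congr 1
  funext s
  rcases s with ⟨a | Y, h⟩ <;> rfl

/-- The full grammar generates the string `S`. -/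
def Generates (G : FullGrammar σ) (S : List (Fin σ)) : Prop :=
  G.start.flatMap G.expandSym = S

/-- The right-hand sides of a full grammar: `none` is the starting string. -/
def rhsOf (G : FullGrammar σ) : Option (Fin G.numNonterminals) → List G.Sym
  | none => G.start
  | some X => G.rule X

/-- The list of all right-hand sides, the starting string first. -/
def rhsList (G : FullGrammar σ) : List (List G.Sym) :=
  G.start :: List.ofFn G.rule

/-- The concatenation of all right-hand sides of the full grammar. -/
def rhs (G : FullGrammar σ) : List G.Sym :=
  G.rhsList.flatten

/-- The pair `p q` occurs at positions `i, i + 1` of the right-hand side with index `r`. -/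
def PairAt (G : FullGrammar σ) (p q : G.Sym) (r : Option (Fin G.numNonterminals)) (i : ℕ) : Prop :=
  (G.rhsOf r)[i]? = some p ∧ (G.rhsOf r)[i + 1]? = some q

/-- Irreducible full grammars: different nonterminals have different expansions, every nonterminal
occurs at least twice in the right-hand sides, and any two occurrences of the same pair in the
right-hand sides overlap (or coincide). -/
structure IsIrreducible (G : FullGrammar σ) : Prop where
  expansion_injective : Function.Injective G.expansion
  two_le_count : ∀ X : Fin G.numNonterminals, 2 ≤ G.rhs.count (Sum.inr X)
  pair_unique : ∀ (p q : G.Sym) (r r' : Option (Fin G.numNonterminals)) (i j : ℕ),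
    G.PairAt p q r i → G.PairAt p q r' j → r = r' ∧ i < j + 2 ∧ j < i + 2

/-- Position of a symbol in the list of the `σ` letters followed by the nonterminals. -/
def symIndex (G : FullGrammar σ) : G.Sym → ℕ
  | Sum.inl a => a.val
  | Sum.inr X => σ + X.val

/-- The common length `⌈log (σ + number of nonterminals)⌉` of the codes of the symbols. -/
def codeLength (G : FullGrammar σ) : ℕ := Nat.clog 2 (σ + G.numNonterminals)

/-- The fixed-length code of a symbol: its index in binary. -/
def symCode (G : FullGrammar σ) (s : G.Sym) : List Bool :=
  (List.range G.codeLength).map fun i => (G.symIndex s).testBit i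

/-- The fully naive encoding: the lengths of all right-hand sides in unary (terminated by a zero),
then the concatenation of the right-hand sides, each symbol written with its fixed-length code. -/
def fullyNaiveEncoding (G : FullGrammar σ) : List Bool :=
  (G.rhsList.flatMap fun u => List.replicate u.length true ++ [false]) ++ G.rhs.flatMap G.symCode

end FullGrammar

/-! Expand every nonterminal exactly once inside `S'`, from the largest to the smallest. The result
still derives `S`, and since each nonterminal occurs at least twice among the right-hand sides, it
still contains each one. Cut all right-hand sides into consecutive pairs beforehand; one expansion
destroys at most one pair. With `g = |S_G|` this leaves `d ≥ g/6` distinct tokens, all single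
symbols or all pairs, whose expansions are disjoint factors of `S` (`exists_distinct_tokens`).

Distinct tokens cannot all be cheap to describe. Encode a token by the lengths of its two halves
(geometric law of parameter `1/M`), two bits for the symbol types, and its text under a source `W`.
Gibbs' inequality gives `d log (d/4) ≤ ∑ -log W + 2 d log M + 4n/M` (`card_mul_logb_le_of_weight`).
If `W` is the empirical source of order `k`, the first `k` letters of a token being uniform, then `∑
-log W ≤ n H_k + d k log σ`, because the tokens are disjoint in `S`. If `W` is uniform, the bound is
`n log σ`, hence `d log n = O(n log σ)`, which makes all error terms `o(n log σ)` for `M = log n`.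
The encoding has about `g log n ≤ 6 d log n` bits. -/

theorem exists_ofFn_eq {α : Type*} {k : ℕ} (c : List α) (h : c.length = k) :
    ∃ v : Fin k → α, List.ofFn v = c := by
  subst h
  exact ⟨c.get, List.ofFn_get c⟩

/-! ### Occurrences in words and the mass of a source of order `k`. -/

section Words

variable {α : Type*} [DecidableEq α]

theorem occurrences_nil_right (v : List α) : occurrences v [] = 0 := by
  simp [occurrences]

theorem occurrences_cons (v w : List α) (a : α) :
    occurrences v (a :: w) = occurrences v w + if v <+: a :: w then 1 else 0 := by
  simp only [occurrences, Finset.card_filter, List.length_cons, Finset.sum_range_succ',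
    List.drop_succ_cons, List.drop_zero]

theorem occurrences_eq_zero_of_length_lt {v w : List α} (h : w.length < v.length) :
    occurrences v w = 0 := by
  induction w with
  | nil => exact occurrences_nil_right v
  | cons a w ih =>
    have h1 : ¬ v <+: a :: w := fun hp => by
      have := hp.length_le
      omega
    rw [occurrences_cons, ih (by simp at h; omega), if_neg h1]

/-- Only occurrences crossing the cut are lost. This is what allows disjoint factors of `S` to share
the entropy of `S`. -/
theorem occurrences_add_le_append (v x y : List α) :
    occurrences v x + occurrences v y ≤ occurrences v (x ++ y) := by
  induction x with
  | nil => simp [occurrences_nil_right]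
  | cons a x ih =>
    rw [List.cons_append, occurrences_cons, occurrences_cons]
    have h : (if v <+: a :: x then 1 else 0) ≤ if v <+: a :: (x ++ y) then 1 else 0 := by
      by_cases h1 : v <+: a :: x
      · have h2 : v <+: a :: (x ++ y) := h1.trans (List.prefix_append (a :: x) y)
        simp [h1, h2]
      · simp [h1]
    omega

theorem sum_occurrences_le_flatMap {β : Type*} (v : List α) (f : β → List α) (L : List β) :
    (L.map fun t => occurrences v (f t)).sum ≤ occurrences v (L.flatMap f) := by
  induction L with
  | nil => simp
  | cons t L ih =>
    rw [List.map_cons, List.sum_cons, List.flatMap_cons]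
    exact (Nat.add_le_add_left ih _).trans (occurrences_add_le_append v _ _)

theorem sum_occurrences_snoc_le [Fintype α] (v w : List α) :
    ∑ a, occurrences (v ++ [a]) w ≤ occurrences v w := by
  induction w with
  | nil => simp [occurrences_nil_right]
  | cons b w ih =>
    simp only [occurrences_cons, Finset.sum_add_distrib]
    refine Nat.add_le_add ih ?_
    by_cases h : v <+: b :: w
    · rw [if_pos h, ← Finset.card_filter, Finset.card_le_one]
      intro a ha a' ha'
      simp only [Finset.mem_filter, Finset.mem_univ, true_and] at ha ha'
      have := List.prefix_of_prefix_length_le ha ha' (by simp)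
      have := this.eq_of_length (by simp)
      simpa using this
    · rw [if_neg h, Finset.sum_eq_zero]
      intro a _
      exact if_neg fun h' => h ((List.prefix_append v [a]).trans h')

theorem occurrences_snoc_le (v w : List α) (a : α) :
    occurrences (v ++ [a]) w ≤ occurrences v w := by
  induction w with
  | nil => simp [occurrences_nil_right]
  | cons b w ih =>
    rw [occurrences_cons, occurrences_cons]
    refine Nat.add_le_add ih ?_
    by_cases h : v ++ [a] <+: b :: w
    · rw [if_pos h, if_pos ((List.prefix_append v [a]).trans h)]
    · simp [h]

variable [Fintype α]

/-- The probability that a source of order `k` with transition probabilities `p` emits the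
letters of `y` that have a full context of length `k` within `y`. -/
noncomputable def contextWeight {k : ℕ} (p : (Fin k → α) → α → ℝ) (y : List α) : ℝ :=
  ∏ v : Fin k → α, ∏ a : α, p v a ^ occurrences (List.ofFn v ++ [a]) y

theorem contextWeight_nonneg {k : ℕ} {p : (Fin k → α) → α → ℝ} (hp : ∀ v a, 0 ≤ p v a)
    (y : List α) : 0 ≤ contextWeight p y :=
  Finset.prod_nonneg fun v _ => Finset.prod_nonneg fun a _ => pow_nonneg (hp v a) _

theorem contextWeight_of_length_le {k : ℕ} (p : (Fin k → α) → α → ℝ) {y : List α}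
    (h : y.length ≤ k) : contextWeight p y = 1 := by
  refine Finset.prod_eq_one fun v _ => Finset.prod_eq_one fun a _ => ?_
  rw [occurrences_eq_zero_of_length_lt (by simp; omega), pow_zero]

theorem contextWeight_context_cons {k : ℕ} (p : (Fin k → α) → α → ℝ) (v : Fin k → α) (a : α)
    (z : List α) :
    contextWeight p (List.ofFn v ++ a :: z) =
      p v a * contextWeight p ((List.ofFn v ++ [a]).tail ++ z) := by
  obtain ⟨b, w, hw⟩ : ∃ b w, List.ofFn v ++ [a] = b :: w :=
    List.exists_cons_of_ne_nil (by simp)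
  have hz : List.ofFn v ++ a :: z = b :: (w ++ z) := by
    rw [← List.cons_append, ← hw]; simp
  have hpre : ∀ (v' : Fin k → α) (a' : α),
      (List.ofFn v' ++ [a'] <+: b :: (w ++ z)) ↔ v' = v ∧ a' = a := by
    intro v' a'
    rw [← List.cons_append, ← hw]
    constructor
    · intro h
      have h1 := List.prefix_of_prefix_length_le h (List.prefix_append _ z) (by simp)
      have h2 := h1.eq_of_length (by simp)
      have h3 := List.append_inj h2 (by simp)
      exact ⟨List.ofFn_injective h3.1, by simpa using h3.2⟩
    · rintro ⟨rfl, rfl⟩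
      exact List.prefix_append _ _
  rw [hz, hw, List.tail_cons]
  unfold contextWeight
  simp only [occurrences_cons, hpre, pow_add, Finset.prod_mul_distrib]
  rw [mul_comm]
  congr 1
  rw [Finset.prod_eq_single v, Finset.prod_eq_single a]
  · simp
  · intro a' _ h; simp [h]
  · simp
  · intro v' _ h; simp [h]
  · simp

/-- Given the context `c`, the weight is the probability that the source emits `z`. Peeling off the
first letter of `z` shifts the context by one. -/
theorem sum_contextWeight_append_le {k : ℕ} {p : (Fin k → α) → α → ℝ} (hp : ∀ v a, 0 ≤ p v a)
    (hp1 : ∀ v, ∑ a, p v a ≤ 1) (m : ℕ) (c : List α) (hc : c.length = k) :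
    ∑ z : Fin m → α, contextWeight p (c ++ List.ofFn z) ≤ 1 := by
  induction m generalizing c with
  | zero => simp [contextWeight_of_length_le p hc.le]
  | succ m ih =>
    obtain ⟨v, rfl⟩ := exists_ofFn_eq c hc
    rw [← (Fin.consEquiv fun _ : Fin (m + 1) => α).sum_comp, Fintype.sum_prod_type]
    refine le_trans (Finset.sum_le_sum fun a _ => ?_) (hp1 v)
    have h : ∀ z : Fin m → α,
        contextWeight p (List.ofFn v ++ List.ofFn (Fin.consEquiv (fun _ : Fin (m + 1) => α) (a, z)))
          = p v a * contextWeight p ((List.ofFn v ++ [a]).tail ++ List.ofFn z) := by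
      intro z
      rw [← contextWeight_context_cons]
      simp [Fin.consEquiv]
    rw [Finset.sum_congr rfl fun z _ => h z, ← Finset.mul_sum]
    exact mul_le_of_le_one_right (hp v a) (ih _ (by simp))

theorem card_le_of_forall_length_eq (m : ℕ) (F : Finset (List α)) (hF : ∀ y ∈ F, y.length = m) :
    F.card ≤ Fintype.card α ^ m := by
  have h : F ⊆ Finset.univ.image (List.ofFn : (Fin m → α) → List α) := by
    intro y hy
    obtain ⟨v, hv⟩ := exists_ofFn_eq y (hF y hy)
    exact Finset.mem_image.2 ⟨v, Finset.mem_univ _, hv⟩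
  refine (Finset.card_le_card h).trans (Finset.card_image_le.trans ?_)
  simp

/-- The first `k` letters have no full context and are taken uniform, which is the factor
`|α|^(-k)`. Words of length at most `k` have context weight 1, and there are at most `|α|^k` of each
length. -/
theorem sum_contextWeight_le [Nonempty α] {k : ℕ} {p : (Fin k → α) → α → ℝ}
    (hp : ∀ v a, 0 ≤ p v a) (hp1 : ∀ v, ∑ a, p v a ≤ 1) (m : ℕ) (F : Finset (List α))
    (hF : ∀ y ∈ F, y.length = m) :
    ∑ y ∈ F, ((Fintype.card α : ℝ) ^ k)⁻¹ * contextWeight p y ≤ 1 := by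
  have hc : (1 : ℝ) ≤ Fintype.card α := by exact_mod_cast Fintype.card_pos
  have hck : (0 : ℝ) < (Fintype.card α : ℝ) ^ k := by positivity
  rw [← Finset.mul_sum, inv_mul_le_iff₀ hck, mul_one]
  rcases le_total m k with hmk | hmk
  · rw [Finset.sum_congr rfl fun y hy =>
      contextWeight_of_length_le p ((hF y hy).le.trans hmk)]
    simp only [Finset.sum_const, nsmul_eq_mul, mul_one]
    calc (F.card : ℝ) ≤ (Fintype.card α : ℝ) ^ m := by
          exact_mod_cast card_le_of_forall_length_eq m F hF
      _ ≤ _ := pow_le_pow_right₀ hc hmk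
  · let f : (Fin k → α) × (Fin (m - k) → α) → List α := fun q => List.ofFn q.1 ++ List.ofFn q.2
    have hinj : Function.Injective f := by
      rintro ⟨v, z⟩ ⟨v', z'⟩ h
      have h' := List.append_inj h (by simp)
      exact Prod.ext (List.ofFn_injective h'.1) (List.ofFn_injective h'.2)
    have hsub : F ⊆ Finset.univ.image f := by
      intro y hy
      obtain ⟨v, hv⟩ := exists_ofFn_eq (k := k) (y.take k) (by simp [hF y hy, hmk])
      obtain ⟨z, hz⟩ := exists_ofFn_eq (k := m - k) (y.drop k) (by simp [hF y hy])
      exact Finset.mem_image.2 ⟨(v, z), Finset.mem_univ _, by simp [f, hv, hz]⟩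
    calc ∑ y ∈ F, contextWeight p y ≤ ∑ y ∈ Finset.univ.image f, contextWeight p y :=
          Finset.sum_le_sum_of_subset_of_nonneg hsub fun y _ _ => contextWeight_nonneg hp y
      _ = ∑ v : Fin k → α, ∑ z : Fin (m - k) → α, contextWeight p (List.ofFn v ++ List.ofFn z) := by
          rw [Finset.sum_image hinj.injOn, Fintype.sum_prod_type]
      _ ≤ ∑ _v : Fin k → α, (1 : ℝ) :=
          Finset.sum_le_sum fun v _ => sum_contextWeight_append_le hp hp1 _ _ (by simp)
      _ = _ := by simp

theorem sum_uniformWeight_le [Nonempty α] (m : ℕ) (F : Finset (List α))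
    (hF : ∀ y ∈ F, y.length = m) :
    ∑ y ∈ F, ((Fintype.card α : ℝ) ^ y.length)⁻¹ ≤ 1 := by
  have hc : (0 : ℝ) < Fintype.card α := by exact_mod_cast Fintype.card_pos
  rw [Finset.sum_congr rfl fun y hy => by rw [hF y hy]]
  rw [Finset.sum_const, nsmul_eq_mul, ← div_eq_mul_inv, div_le_one (by positivity)]
  exact_mod_cast card_le_of_forall_length_eq m F hF

end Words

/-! ### Lower bounds for the total code length of distinct words. -/

theorem card_mul_logb_le_sum {ι : Type*} (D : Finset ι) (V : ι → ℝ) (hV : ∀ i ∈ D, 0 < V i)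
    {m : ℝ} (hm : 0 < m) (h : ∑ i ∈ D, V i ≤ m) :
    D.card * Real.logb 2 (D.card / m) ≤ ∑ i ∈ D, -Real.logb 2 (V i) := by
  rcases D.eq_empty_or_nonempty with rfl | hD
  · simp
  have hd : (0 : ℝ) < D.card := by exact_mod_cast hD.card_pos
  have h2 : 0 < Real.log 2 := Real.log_pos one_lt_two
  -- Gibbs' inequality against the uniform law on `D`, from `log x ≤ x - 1`.
  have key : ∑ i ∈ D, Real.log (V i * (D.card / m)) ≤ 0 := by
    calc ∑ i ∈ D, Real.log (V i * (D.card / m)) ≤ ∑ i ∈ D, (V i * (D.card / m) - 1) :=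
          Finset.sum_le_sum fun i hi =>
            Real.log_le_sub_one_of_pos (mul_pos (hV i hi) (by positivity))
      _ = (∑ i ∈ D, V i) * (D.card / m) - D.card := by
          rw [Finset.sum_sub_distrib, Finset.sum_mul]; simp
      _ ≤ m * (D.card / m) - D.card := by gcongr
      _ = 0 := by field_simp; ring
  have e : ∑ i ∈ D, Real.log (V i * (D.card / m)) =
      ∑ i ∈ D, Real.log (V i) + D.card * Real.log (D.card / m) := by
    rw [Finset.sum_congr rfl fun i hi =>
      Real.log_mul (hV i hi).ne' (by positivity : (D.card : ℝ) / m ≠ 0)]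
    rw [Finset.sum_add_distrib]; simp
  simp only [Real.logb]
  rw [Finset.sum_neg_distrib, ← Finset.sum_div, mul_div_assoc', ← neg_div]
  exact div_le_div_of_nonneg_right (by linarith) h2.le

/-- Distinct pairs of words of total length at most `n` need long codewords. -/
theorem card_mul_logb_le_of_weight {α ι : Type*} [DecidableEq α] (W : List α → ℝ)
    (hW : ∀ (m : ℕ) (F : Finset (List α)), (∀ y ∈ F, y.length = m) → ∑ y ∈ F, W y ≤ 1)
    (D : Finset ι) (u₁ u₂ : ι → List α) (b : ι → Bool × Bool)
    (inj : Set.InjOn (fun i => (u₁ i, u₂ i, b i)) D)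
    (hpos : ∀ i ∈ D, 0 < W (u₁ i ++ u₂ i)) (n : ℕ)
    (hlen : ∑ i ∈ D, (u₁ i ++ u₂ i).length ≤ n) (M : ℝ) (hM : 2 ≤ M) :
    D.card * Real.logb 2 (D.card / 4) ≤
      ∑ i ∈ D, -Real.logb 2 (W (u₁ i ++ u₂ i)) + 2 * D.card * Real.logb 2 M + 4 * n / M := by
  have hM0 : 0 < M := by linarith
  set θ : ℝ := 1 - 1 / M with hθ
  have hM1 : 1 / M ≤ 1 / 2 := one_div_le_one_div_of_le (by norm_num) hM
  have hMi : 0 < 1 / M := by positivity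
  have hθ0 : 0 < θ := by rw [hθ]; linarith
  -- Both lengths follow the geometric law of parameter `1/M`: each costs `log M` bits plus `-log θ
  -- = O(1/M)` per letter.
  let V : ι → ℝ := fun i =>
    (1 / M * θ ^ (u₁ i).length) * (1 / M * θ ^ (u₂ i).length) * W (u₁ i ++ u₂ i)
  have hV : ∀ i ∈ D, 0 < V i := fun i hi => by
    have := hpos i hi
    positivity
  have hgeom : ∀ N : ℕ, ∑ l ∈ Finset.range N, 1 / M * θ ^ l ≤ 1 := by
    intro N
    rw [← Finset.mul_sum]
    have h1 : 1 / M = 1 - θ := by rw [hθ]; ring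
    rw [h1, mul_neg_geom_sum]
    have : 0 ≤ θ ^ N := by positivity
    linarith
  -- The 4 is the number of values of `b`; for each of them the total mass is at most 1.
  have hsum : ∑ i ∈ D, V i ≤ 4 := by
    let K : Finset ((ℕ × ℕ) × (Bool × Bool)) :=
      (Finset.range (n + 1) ×ˢ Finset.range (n + 1)) ×ˢ Finset.univ
    let key : ι → (ℕ × ℕ) × (Bool × Bool) := fun i => (((u₁ i).length, (u₂ i).length), b i)
    have hkey : ∀ i ∈ D, key i ∈ K := by
      intro i hi
      have h1 : (u₁ i ++ u₂ i).length ≤ n :=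
        (Finset.single_le_sum (f := fun i => (u₁ i ++ u₂ i).length)
          (fun _ _ => Nat.zero_le _) hi).trans hlen
      rw [List.length_append] at h1
      simp only [K, key, Finset.mem_product, Finset.mem_range, Finset.mem_univ, and_true]
      omega
    rw [← Finset.sum_fiberwise_of_maps_to hkey]
    have hfib : ∀ c ∈ K, ∑ i ∈ D with key i = c, V i ≤
        (1 / M * θ ^ c.1.1) * (1 / M * θ ^ c.1.2) := by
      rintro ⟨⟨l₁, l₂⟩, c⟩ _
      -- Once both lengths and `b` are fixed, the concatenation determines the pair.
      have hinj : Set.InjOn (fun i => u₁ i ++ u₂ i)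
          (D.filter fun i => key i = ((l₁, l₂), c) : Finset ι) := by
        intro i hi j hj hij
        simp only [Finset.coe_filter, Set.mem_ofPred_eq, key, Prod.mk.injEq] at hi hj
        have h' := List.append_inj hij (by rw [hi.2.1.1, hj.2.1.1])
        exact inj hi.1 hj.1 (by simp [h'.1, h'.2, hi.2.2, hj.2.2])
      have hle : ∑ i ∈ D with key i = ((l₁, l₂), c), W (u₁ i ++ u₂ i) ≤ 1 := by
        rw [← Finset.sum_image (f := W) hinj]
        refine hW (l₁ + l₂) _ fun y hy => ?_
        obtain ⟨i, hi, rfl⟩ := Finset.mem_image.1 hy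
        simp only [Finset.mem_filter, key, Prod.mk.injEq] at hi
        rw [List.length_append, hi.2.1.1, hi.2.1.2]
      have heq : ∑ i ∈ D with key i = ((l₁, l₂), c), V i =
          (1 / M * θ ^ l₁) * (1 / M * θ ^ l₂) *
            ∑ i ∈ D with key i = ((l₁, l₂), c), W (u₁ i ++ u₂ i) := by
        rw [Finset.mul_sum]
        refine Finset.sum_congr rfl fun i hi => ?_
        simp only [Finset.mem_filter, key, Prod.mk.injEq] at hi
        simp only [V, hi.2.1.1, hi.2.1.2]
      rw [heq]
      exact mul_le_of_le_one_right (by positivity) hle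
    refine (Finset.sum_le_sum hfib).trans ?_
    rw [Finset.sum_product]
    simp only [Finset.sum_const, nsmul_eq_mul, Finset.card_univ, Fintype.card_prod,
      Fintype.card_bool]
    rw [← Finset.mul_sum, Finset.sum_product]
    simp only [← Finset.mul_sum]
    rw [← Finset.sum_mul]
    have h0 : 0 ≤ ∑ l ∈ Finset.range (n + 1), 1 / M * θ ^ l :=
      Finset.sum_nonneg fun l _ => by positivity
    have h1 := mul_le_one₀ (hgeom (n + 1)) h0 (hgeom (n + 1))
    rw [← Finset.mul_sum (Finset.range (n + 1)) (fun l => θ ^ l) (1 / M)] at h1 ⊢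
    push_cast
    linarith
  refine (card_mul_logb_le_sum D V hV (by norm_num) hsum).trans ?_
  -- Since `θ ≥ 1/2`, `θ⁻¹ - 1 ≤ 2/M`; dividing by `log 2 > 1/2` at most doubles this.
  have hlogθ : -Real.logb 2 θ ≤ 4 / M := by
    have h2 : (1 : ℝ) / 2 < Real.log 2 := by have := Real.log_two_gt_d9; linarith
    have h3 : Real.log θ⁻¹ ≤ θ⁻¹ - 1 := Real.log_le_sub_one_of_pos (by positivity)
    have h4 : θ⁻¹ - 1 ≤ 2 / M := by
      have : θ⁻¹ - 1 = 1 / M / θ := by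
        rw [show 1 / M = 1 - θ by rw [hθ]; ring, sub_div, div_self hθ0.ne', one_div]
      rw [this, div_le_iff₀ hθ0]
      have : 2 / M * θ = 1 / M * (2 * θ) := by ring
      rw [this]
      exact le_mul_of_one_le_right hMi.le (by rw [hθ]; linarith)
    rw [Real.log_inv] at h3
    rw [Real.logb, ← neg_div, div_le_iff₀ (by linarith)]
    calc -Real.log θ ≤ 2 / M := by linarith
      _ = 4 / M * (1 / 2) := by ring
      _ ≤ _ := by gcongr
  have hi : ∀ i ∈ D, -Real.logb 2 (V i) ≤ -Real.logb 2 (W (u₁ i ++ u₂ i)) + 2 * Real.logb 2 M +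
      4 / M * ((u₁ i ++ u₂ i).length : ℝ) := by
    intro i hi
    have hw := hpos i hi
    have e : Real.logb 2 (V i) = Real.logb 2 (W (u₁ i ++ u₂ i)) - 2 * Real.logb 2 M +
        Real.logb 2 θ * ((u₁ i ++ u₂ i).length : ℝ) := by
      simp only [V]
      rw [Real.logb_mul (by positivity) hw.ne', Real.logb_mul (by positivity) (by positivity),
        Real.logb_mul (by positivity) (by positivity),
        Real.logb_mul (by positivity) (by positivity), Real.logb_pow, Real.logb_pow,
        one_div, Real.logb_inv, List.length_append]
      push_cast
      ring
    rw [e]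
    have := mul_le_mul_of_nonneg_right hlogθ (Nat.cast_nonneg (u₁ i ++ u₂ i).length)
    linarith
  refine (Finset.sum_le_sum hi).trans ?_
  rw [Finset.sum_add_distrib, Finset.sum_add_distrib, Finset.sum_const,
    nsmul_eq_mul, ← Finset.mul_sum]
  have hlen' : (∑ i ∈ D, ((u₁ i ++ u₂ i).length : ℝ)) ≤ n := by exact_mod_cast hlen
  have : 4 / M * ∑ i ∈ D, ((u₁ i ++ u₂ i).length : ℝ) ≤ 4 * n / M := by
    calc _ ≤ 4 / M * (n : ℝ) := by gcongr
      _ = _ := by ring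
  linarith

/-! ### Empirical entropy as a code length. -/

section Entropy

variable {α : Type*} [DecidableEq α]

/-- The empirical transition probabilities of order `k` of the word `w`. -/
noncomputable def empiricalProb {k : ℕ} (w : List α) (v : Fin k → α) (a : α) : ℝ :=
  (occurrences (List.ofFn v ++ [a]) w : ℝ) / (occurrences (List.ofFn v) w : ℝ)

theorem empiricalProb_nonneg {k : ℕ} (w : List α) (v : Fin k → α) (a : α) :
    0 ≤ empiricalProb w v a := by
  unfold empiricalProb; positivity

theorem empiricalProb_le_one {k : ℕ} (w : List α) (v : Fin k → α) (a : α) :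
    empiricalProb w v a ≤ 1 :=
  div_le_one_of_le₀ (by exact_mod_cast occurrences_snoc_le _ w a) (by positivity)

theorem empiricalProb_pos {k : ℕ} {w : List α} {v : Fin k → α} {a : α}
    (h : 0 < occurrences (List.ofFn v ++ [a]) w) : 0 < empiricalProb w v a := by
  have h' := h.trans_le (occurrences_snoc_le (List.ofFn v) w a)
  unfold empiricalProb
  positivity

theorem empiricalProb_neg_logb_nonneg {k : ℕ} (w : List α) (v : Fin k → α) (a : α) :
    0 ≤ -Real.logb 2 (empiricalProb w v a) := by
  rw [neg_nonneg]
  exact Real.logb_nonpos one_lt_two (empiricalProb_nonneg w v a) (empiricalProb_le_one w v a)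

variable [Fintype α]

/-- Equality can fail: an occurrence of `v` at the end of `w` has no next letter, and if `v` does
not occur all quotients are `0/0 = 0`. -/
theorem sum_empiricalProb_le {k : ℕ} (w : List α) (v : Fin k → α) :
    ∑ a, empiricalProb w v a ≤ 1 := by
  unfold empiricalProb
  rw [← Finset.sum_div]
  exact div_le_one_of_le₀ (by exact_mod_cast sum_occurrences_snoc_le _ w) (by positivity)

theorem length_mul_empiricalEntropy (k : ℕ) (w : List α) (hw : w ≠ []) :
    (w.length : ℝ) * empiricalEntropy k w =
      ∑ v : Fin k → α, ∑ a : α,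
        (occurrences (List.ofFn v ++ [a]) w : ℝ) * -Real.logb 2 (empiricalProb w v a) := by
  have : (w.length : ℝ) ≠ 0 := by
    simpa using hw
  unfold empiricalEntropy empiricalProb
  simp only [mul_neg, Finset.sum_neg_distrib]
  field_simp

theorem length_mul_empiricalEntropy_nonneg (k : ℕ) (w : List α) (hw : w ≠ []) :
    0 ≤ (w.length : ℝ) * empiricalEntropy k w := by
  rw [length_mul_empiricalEntropy k w hw]
  exact Finset.sum_nonneg fun v _ => Finset.sum_nonneg fun a _ =>
    mul_nonneg (Nat.cast_nonneg _) (empiricalProb_neg_logb_nonneg w v a)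

variable {ι : Type*} {D : Finset ι} {y : ι → List α} {w : List α}

theorem contextWeight_pos_of_occurrences_le {k : ℕ} {x : List α}
    (h : ∀ u, occurrences u x ≤ occurrences u w) :
    0 < contextWeight (k := k) (empiricalProb w) x := by
  refine Finset.prod_pos fun v _ => Finset.prod_pos fun a _ => ?_
  rcases Nat.eq_zero_or_pos (occurrences (List.ofFn v ++ [a]) x) with h0 | h0
  · simp [h0]
  · exact pow_pos (empiricalProb_pos (h0.trans_le (h _))) _

theorem neg_logb_contextWeight {k : ℕ} {x : List α}
    (h : ∀ u, occurrences u x ≤ occurrences u w) :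
    -Real.logb 2 (contextWeight (k := k) (empiricalProb w) x) =
      ∑ v : Fin k → α, ∑ a : α,
        (occurrences (List.ofFn v ++ [a]) x : ℝ) * -Real.logb 2 (empiricalProb w v a) := by
  have hne : ∀ (v : Fin k → α) (a : α),
      empiricalProb w v a ^ occurrences (List.ofFn v ++ [a]) x ≠ 0 := by
    intro v a
    rcases Nat.eq_zero_or_pos (occurrences (List.ofFn v ++ [a]) x) with h0 | h0
    · simp [h0]
    · exact (pow_pos (empiricalProb_pos (h0.trans_le (h _))) _).ne'
  unfold contextWeight
  rw [Real.logb_prod _ _ fun v _ => Finset.prod_ne_zero_iff.2 fun a _ => hne v a]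
  simp only [mul_neg, Finset.sum_neg_distrib]
  congr 1
  refine Finset.sum_congr rfl fun v _ => ?_
  rw [Real.logb_prod _ _ fun a _ => hne v a]
  simp only [Real.logb_pow]

/-- Each transition has a nonnegative cost and is used in the `y i` together at most as often as in
`w`. Every `y i` pays `k log |α|` for its letters without full context. -/
theorem sum_neg_logb_contextWeight_le [Nonempty α] (k : ℕ) (hw : w ≠ [])
    (h : ∀ u, ∑ i ∈ D, occurrences u (y i) ≤ occurrences u w) :
    ∑ i ∈ D, -Real.logb 2 (((Fintype.card α : ℝ) ^ k)⁻¹ *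
        contextWeight (k := k) (empiricalProb w) (y i)) ≤
      w.length * empiricalEntropy k w + D.card * (k * Real.logb 2 (Fintype.card α)) := by
  have hc : (0 : ℝ) < Fintype.card α := by exact_mod_cast Fintype.card_pos
  have hi : ∀ i ∈ D, ∀ u, occurrences u (y i) ≤ occurrences u w := fun i hi u =>
    (Finset.single_le_sum (f := fun i => occurrences u (y i))
      (fun _ _ => Nat.zero_le _) hi).trans (h u)
  have e : ∀ i ∈ D, -Real.logb 2 (((Fintype.card α : ℝ) ^ k)⁻¹ *
        contextWeight (k := k) (empiricalProb w) (y i)) =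
      k * Real.logb 2 (Fintype.card α) + ∑ v : Fin k → α, ∑ a : α,
        (occurrences (List.ofFn v ++ [a]) (y i) : ℝ) * -Real.logb 2 (empiricalProb w v a) := by
    intro i hiD
    rw [Real.logb_mul (by positivity) (contextWeight_pos_of_occurrences_le (hi i hiD)).ne',
      ← neg_logb_contextWeight (hi i hiD), Real.logb_inv, Real.logb_pow]
    ring
  rw [Finset.sum_congr rfl e, Finset.sum_add_distrib, Finset.sum_const, nsmul_eq_mul, add_comm,
    length_mul_empiricalEntropy k w hw]
  refine add_le_add_left ?_ _
  rw [Finset.sum_comm]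
  refine Finset.sum_le_sum fun v _ => ?_
  rw [Finset.sum_comm]
  refine Finset.sum_le_sum fun a _ => ?_
  rw [← Finset.sum_mul]
  refine mul_le_mul_of_nonneg_right ?_ (empiricalProb_neg_logb_nonneg w v a)
  exact_mod_cast h _

end Entropy

/-! ### Cutting lists into pairs. -/

/-- Cut a list into consecutive pairs; a last single element may remain. -/
def pairUp {β : Type*} : List β → List (List β)
  | [] => []
  | [a] => [[a]]
  | a :: b :: l => [a, b] :: pairUp l

theorem flatten_pairUp {β : Type*} (l : List β) : (pairUp l).flatten = l := by
  induction l using pairUp.induct with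
  | case1 => rfl
  | case2 a => rfl
  | case3 a b l ih => simp [pairUp, ih]

theorem length_le_two_of_mem_pairUp {β : Type*} (l : List β) :
    ∀ t ∈ pairUp l, t.length ≤ 2 := by
  induction l using pairUp.induct with
  | case1 => simp [pairUp]
  | case2 a => simp [pairUp]
  | case3 a b l ih => simpa [pairUp] using ih

theorem length_le_countP_pairUp {β : Type*} (l : List β) :
    l.length ≤ 2 * (pairUp l).countP (fun t => t.length == 2) + 1 := by
  induction l using pairUp.induct with
  | case1 => simp
  | case2 a => simp
  | case3 a b l ih =>
    simp only [pairUp, List.length_cons, List.countP_cons]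
    simp
    omega

theorem getElem?_of_getElem?_pairUp {β : Type*} (l : List β) (i : ℕ) (p q : β)
    (h : (pairUp l)[i]? = some [p, q]) : l[2 * i]? = some p ∧ l[2 * i + 1]? = some q := by
  induction l using pairUp.induct generalizing i with
  | case1 => simp [pairUp] at h
  | case2 a => cases i <;> simp [pairUp] at h
  | case3 a b l ih =>
    cases i with
    | zero => simpa [pairUp] using h
    | succ i =>
      rw [pairUp, List.getElem?_cons_succ] at h
      simpa [Nat.mul_add] using ih i h

instance {α β : Type*} [BEq α] [BEq β] [LawfulBEq α] [LawfulBEq β] : LawfulBEq (α ⊕ β) where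
  eq_of_beq {x y} h := by
    rcases x with a | b <;> rcases y with a' | b'
    · exact congrArg Sum.inl (LawfulBEq.eq_of_beq (show (a == a') = true from h))
    · exact Bool.noConfusion h
    · exact Bool.noConfusion h
    · exact congrArg Sum.inr (LawfulBEq.eq_of_beq (show (b == b') = true from h))
  rfl {x} := by
    rcases x with a | b
    · exact (beq_self_eq_true a : (a == a) = true)
    · exact (beq_self_eq_true b : (b == b) = true)

theorem sum_count_inr_le_length {α β : Type*} [DecidableEq α] [DecidableEq β] [Fintype β]
    (l : List (α ⊕ β)) : ∑ b : β, l.count (Sum.inr b) ≤ l.length := by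
  induction l with
  | nil => simp
  | cons s l ih =>
    simp only [List.count_cons, Finset.sum_add_distrib, List.length_cons]
    refine Nat.add_le_add ih ?_
    rcases s with a | b
    · simp
    · simp

/-! ### Expanding each nonterminal once, and distinct tokens. -/

namespace FullGrammar

variable {σ : ℕ}

theorem count_rhs (G : FullGrammar σ) (s : G.Sym) :
    G.rhs.count s = G.start.count s + ∑ Y, (G.rule Y).count s := by
  simp [rhs, rhsList, List.count_flatten, List.map_ofFn, List.sum_ofFn]

theorem length_rhs (G : FullGrammar σ) :
    G.rhs.length = G.start.length + ∑ Y, (G.rule Y).length := by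
  simp [rhs, rhsList, List.length_flatten, List.map_ofFn, List.sum_ofFn]

/-- The tokens `T` arise from the pairs of `S'` when one occurrence of each nonterminal in `A`
is replaced by the pairs of its right-hand side. -/
structure IsPartialDerivation (G : FullGrammar σ) (S : List (Fin σ))
    (A : Finset (Fin G.numNonterminals)) (T : List (List G.Sym)) : Prop where
  expand : T.flatten.flatMap G.expandSym = S
  length_le : ∀ t ∈ T, t.length ≤ 2
  -- Each expanded nonterminal has used up one of its occurrences.
  count_add : ∀ X, T.flatten.count (Sum.inr X) + (if X ∈ A then 1 else 0) =
    G.start.count (Sum.inr X) + ∑ Y ∈ A, (G.rule Y).count (Sum.inr X)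
  count_pair_le : ∀ t : List G.Sym, t.length = 2 →
    T.count t ≤ (pairUp G.start).count t + ∑ Y ∈ A, (pairUp (G.rule Y)).count t
  -- Each expansion destroys at most one pair.
  le_countP : (pairUp G.start).countP (fun t => t.length == 2) +
    ∑ Y ∈ A, (pairUp (G.rule Y)).countP (fun t => t.length == 2) ≤
      T.countP (fun t => t.length == 2) + A.card

theorem isPartialDerivation_start {G : FullGrammar σ} {S : List (Fin σ)} (h : G.Generates S) :
    G.IsPartialDerivation S ∅ (pairUp G.start) where
  expand := by rw [flatten_pairUp]; exact h
  length_le := length_le_two_of_mem_pairUp _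
  count_add := by simp [flatten_pairUp]
  count_pair_le := by simp
  le_countP := by simp

theorem IsPartialDerivation.exists_insert {G : FullGrammar σ} {S : List (Fin σ)}
    {A : Finset (Fin G.numNonterminals)} {T : List (List G.Sym)}
    (h : G.IsPartialDerivation S A T) {X : Fin G.numNonterminals} (hX : X ∉ A)
    (hXT : Sum.inr X ∈ T.flatten) : ∃ T', G.IsPartialDerivation S (insert X A) T' := by
  obtain ⟨t, ht, hXt⟩ := List.mem_flatten.1 hXT
  obtain ⟨T₁, T₂, rfl⟩ := List.append_of_mem ht
  obtain ⟨c, e, rfl⟩ := List.append_of_mem hXt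
  have hlen : c.length + e.length ≤ 1 := by
    have := h.length_le _ ht
    simp at this
    omega
  -- The remainders `c` and `e` of the broken token have at most one symbol in total and stay
  -- separate tokens, so no new pair arises.
  refine ⟨T₁ ++ c :: (pairUp (G.rule X) ++ e :: T₂), ?_, ?_, ?_, ?_, ?_⟩
  · rw [← h.expand]
    simp [flatten_pairUp, List.flatMap_append, expandSym, expansion_eq]
  · intro t ht
    simp only [List.mem_append, List.mem_cons] at ht
    rcases ht with ht | rfl | ht | rfl | ht
    · exact h.length_le t (by simp [ht])
    · omega
    · exact length_le_two_of_mem_pairUp _ t ht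
    · omega
    · exact h.length_le t (by simp [ht])
  · intro Z
    have := h.count_add Z
    rw [Finset.sum_insert hX]
    simp only [List.flatten_append, List.flatten_cons, List.count_append, List.count_cons,
      flatten_pairUp, Finset.mem_insert] at this ⊢
    by_cases hZ : Z = X
    · subst hZ
      simp [hX] at this ⊢
      omega
    · have hZ' : X ≠ Z := fun h => hZ h.symm
      simp [hZ, hZ'] at this ⊢
      omega
  · intro t ht
    have := h.count_pair_le t ht
    have hc : c ≠ t := by rintro rfl; omega
    have he : e ≠ t := by rintro rfl; omega
    rw [Finset.sum_insert hX]
    simp only [List.count_append, List.count_cons] at this ⊢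
    simp [hc, he]
    omega
  · have := h.le_countP
    rw [Finset.sum_insert hX, Finset.card_insert_of_notMem hX]
    have hc : (c.length == 2) = false := by simp; omega
    have he : (e.length == 2) = false := by simp; omega
    simp only [List.countP_append, List.countP_cons, hc, he, Sym, Bool.false_eq_true,
      if_false] at this ⊢
    have h1 : ∀ b : Bool, (if b = true then 1 else 0) ≤ 1 := by decide
    have := h1 ((c ++ Sum.inr X :: e).length == 2)
    omega

/-- Nonterminals are inserted in decreasing order. When the turn of `X` comes, every rule containing
`X` has been used and no `X` has been expanded, so at least two are available. -/
theorem IsIrreducible.exists_isPartialDerivation {G : FullGrammar σ} {S : List (Fin σ)}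
    (hG : G.IsIrreducible) (hS : G.Generates S) :
    ∃ T, G.IsPartialDerivation S Finset.univ T := by
  have main : ∀ m ≤ G.numNonterminals, ∃ T, G.IsPartialDerivation S
      (Finset.univ.filter fun Y => G.numNonterminals ≤ Y.val + m) T := by
    intro m hm
    induction m with
    | zero =>
      have : (Finset.univ.filter fun Y : Fin G.numNonterminals =>
          G.numNonterminals ≤ Y.val + 0) = ∅ := by
        ext Y; simp
      rw [this]
      exact ⟨_, isPartialDerivation_start hS⟩
    | succ m ih =>
      obtain ⟨T, hT⟩ := ih (by omega)
      let X : Fin G.numNonterminals := ⟨G.numNonterminals - m - 1, by omega⟩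
      have hXv : X.val = G.numNonterminals - m - 1 := rfl
      have hins : (Finset.univ.filter fun Y : Fin G.numNonterminals =>
          G.numNonterminals ≤ Y.val + (m + 1)) =
          insert X (Finset.univ.filter fun Y => G.numNonterminals ≤ Y.val + m) := by
        ext Y
        simp only [Finset.mem_filter, Finset.mem_univ, true_and, Finset.mem_insert, Fin.ext_iff]
        omega
      have hX : X ∉ Finset.univ.filter fun Y : Fin G.numNonterminals =>
          G.numNonterminals ≤ Y.val + m := by
        simp only [Finset.mem_filter, Finset.mem_univ, true_and]
        omega
      rw [hins]
      refine hT.exists_insert hX ?_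
      have h2 := hG.two_le_count X
      have h3 := hT.count_add X
      rw [count_rhs] at h2
      have h4 : ∑ Y ∈ Finset.univ.filter fun Y : Fin G.numNonterminals =>
          G.numNonterminals ≤ Y.val + m, (G.rule Y).count (Sum.inr X) =
          ∑ Y, (G.rule Y).count (Sum.inr X) := by
        refine Finset.sum_subset (Finset.filter_subset _ _) fun Y _ hY => ?_
        refine List.count_eq_zero.2 fun hY' => ?_
        have h5 : X.val < Y.val := G.acyclic Y X hY'
        simp only [Finset.mem_filter, Finset.mem_univ, true_and] at hY
        omega
      rw [if_neg hX, h4] at h3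
      exact List.count_pos_iff.1 (by omega)
  obtain ⟨T, hT⟩ := main _ le_rfl
  have : (Finset.univ.filter fun Y : Fin G.numNonterminals =>
      G.numNonterminals ≤ Y.val + G.numNonterminals) = Finset.univ := by
    ext Y; simp
  exact ⟨T, this ▸ hT⟩

/-- `pairUp` takes pairs at even positions only, so two different ones never overlap and
irreducibility applies, even to runs such as `aaa`. -/
theorem IsIrreducible.count_pairUp_le_one {G : FullGrammar σ} (hG : G.IsIrreducible)
    (p q : G.Sym) :
    (pairUp G.start).count [p, q] + ∑ Y, (pairUp (G.rule Y)).count [p, q] ≤ 1 := by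
  have hat : ∀ (r : Option (Fin G.numNonterminals)) (i : ℕ),
      (pairUp (G.rhsOf r))[i]? = some [p, q] → G.PairAt p q r (2 * i) := fun r i h =>
    getElem?_of_getElem?_pairUp _ i p q h
  have hone : ∀ r, (pairUp (G.rhsOf r)).count [p, q] ≤ 1 := by
    intro r
    by_contra! hcon
    obtain ⟨i, j, hij, hi, hj⟩ :=
      List.duplicate_iff_exists_distinct_get.1
        (List.duplicate_iff_sublist.2 (List.replicate_sublist_iff.2 hcon))
    have h1 := hat r i (by rw [hi, List.get_eq_getElem]; simp)
    have h2 := hat r j (by rw [hj, List.get_eq_getElem]; simp)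
    have h3 := hG.pair_unique p q r r _ _ h1 h2
    have h4 : i.val < j.val := hij
    omega
  have hrw : (pairUp G.start).count [p, q] + ∑ Y, (pairUp (G.rule Y)).count [p, q] =
      ∑ r, (pairUp (G.rhsOf r)).count [p, q] := by
    rw [Fintype.sum_option]; rfl
  rw [hrw]
  by_cases hex : ∃ r, [p, q] ∈ pairUp (G.rhsOf r)
  · obtain ⟨r, hr⟩ := hex
    rw [Finset.sum_eq_single r]
    · exact hone r
    · intro r' _ hne
      refine List.count_eq_zero.2 fun hr' => hne ?_
      obtain ⟨i, hi⟩ := List.mem_iff_getElem?.1 hr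
      obtain ⟨j, hj⟩ := List.mem_iff_getElem?.1 hr'
      exact (hG.pair_unique p q r' r _ _ (hat r' j hj) (hat r i hi)).1
    · simp
  · push Not at hex
    rw [Finset.sum_eq_zero fun r _ => List.count_eq_zero.2 (hex r)]
    exact Nat.zero_le _

theorem IsIrreducible.two_mul_numNonterminals_le {G : FullGrammar σ} (hG : G.IsIrreducible) :
    2 * G.numNonterminals ≤ G.rhs.length := by
  have h := sum_count_inr_le_length G.rhs
  refine le_trans ?_ h
  calc 2 * G.numNonterminals = ∑ _X : Fin G.numNonterminals, 2 := by simp [mul_comm]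
    _ ≤ _ := Finset.sum_le_sum fun X _ => hG.two_le_count X

/-- Let `N` be the number of nonterminals. If `g ≤ 6N`, the nonterminals surviving in `T` are enough
distinct symbols. Otherwise at least `(g - N - 1)/2` pairs are cut, at most `N` are destroyed, and
`(g - 3N - 1)/2 ≥ g/6` remain. -/
theorem IsIrreducible.exists_distinct_tokens {G : FullGrammar σ} {S : List (Fin σ)}
    (hG : G.IsIrreducible) (hS : G.Generates S) (hsize : 6 ≤ G.rhs.length) :
    ∃ T D : List (List G.Sym), T.flatten.flatMap G.expandSym = S ∧ D.Sublist T ∧ D.Nodup ∧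
      ((∀ t ∈ D, t.length = 1) ∨ ∀ t ∈ D, t.length = 2) ∧ G.rhs.length ≤ 6 * D.length := by
  obtain ⟨T, hT⟩ := hG.exists_isPartialDerivation hS
  rcases le_or_gt G.rhs.length (6 * G.numNonterminals) with hN | hN
  · refine ⟨T.flatten.map fun s => [s], T.flatten.dedup.map fun s => [s], ?_,
      (List.dedup_sublist _).map _, (List.nodup_dedup _).map fun _ _ h => by simpa using h,
      Or.inl ?_, ?_⟩
    · rw [← hT.expand, ← List.flatMap_def, List.flatMap_singleton']
    · intro t ht
      obtain ⟨s, -, rfl⟩ := List.mem_map.1 ht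
      rfl
    · rw [List.length_map]
      have hsub : Finset.univ.image (Sum.inr : Fin G.numNonterminals → G.Sym) ⊆
          T.flatten.toFinset := by
        intro s hs
        obtain ⟨X, -, rfl⟩ := Finset.mem_image.1 hs
        have h1 := hT.count_add X
        have h2 := hG.two_le_count X
        rw [count_rhs] at h2
        rw [if_pos (Finset.mem_univ X)] at h1
        exact List.mem_toFinset.2 (List.count_pos_iff.1 (by omega))
      have := Finset.card_le_card hsub
      rw [Finset.card_image_of_injective _ Sum.inr_injective, List.card_toFinset] at this
      simp only [Finset.card_univ, Fintype.card_fin] at this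
      omega
  · refine ⟨T, T.filter fun t => t.length == 2, hT.expand, List.filter_sublist, ?_,
      Or.inr (by simp), ?_⟩
    · refine List.nodup_iff_count_le_one.2 fun t => ?_
      by_cases ht : t.length = 2
      · rw [List.count_filter (by simpa using ht)]
        refine (hT.count_pair_le t ht).trans ?_
        obtain ⟨p, q, rfl⟩ := List.length_eq_two.1 ht
        exact hG.count_pairUp_le_one p q
      · rw [List.count_eq_zero.2 (by simp [ht])]
        exact Nat.zero_le _
    · rw [← List.countP_eq_length_filter]
      have h1 := hT.le_countP
      have h2 := length_le_countP_pairUp G.start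
      have h3 : ∑ Y, (G.rule Y).length ≤
          ∑ Y, (2 * (pairUp (G.rule Y)).countP (fun t => t.length == 2) + 1) :=
        Finset.sum_le_sum fun Y _ => length_le_countP_pairUp (G.rule Y)
      rw [Finset.sum_add_distrib, ← Finset.mul_sum] at h3
      simp only [Finset.sum_const, Finset.card_univ, Fintype.card_fin, smul_eq_mul,
        mul_one] at h1 h3
      have h4 := length_rhs G
      omega

/-! ### Code-length bounds for the tokens of a grammar. -/

theorem IsIrreducible.expandSym_injective {G : FullGrammar σ} (hG : G.IsIrreducible)
    {s s' : G.Sym} (h : G.expandSym s = G.expandSym s') (h' : s.isLeft = s'.isLeft) : s = s' := by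
  rcases s with a | X <;> rcases s' with a' | X'
  · simpa [expandSym] using h
  · simp at h'
  · simp at h'
  · rw [hG.expansion_injective h]

/-- The tokens of an irreducible grammar need long codewords. -/
theorem IsIrreducible.card_mul_logb_le {G : FullGrammar σ} {S : List (Fin σ)}
    (hG : G.IsIrreducible) {T D : List (List G.Sym)} (hT : T.flatten.flatMap G.expandSym = S)
    (hDT : D.Sublist T) (hD : D.Nodup)
    (hlen : (∀ t ∈ D, t.length = 1) ∨ ∀ t ∈ D, t.length = 2)
    (W : List (Fin σ) → ℝ)
    (hW : ∀ (m : ℕ) (F : Finset (List (Fin σ))), (∀ y ∈ F, y.length = m) → ∑ y ∈ F, W y ≤ 1)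
    (C : ℝ)
    (hcost : ∀ y : List G.Sym → List (Fin σ),
      (∀ u, ∑ t ∈ D.toFinset, occurrences u (y t) ≤ occurrences u S) →
      ∑ t ∈ D.toFinset, (y t).length ≤ S.length →
      (∀ t ∈ D.toFinset, 0 < W (y t)) ∧ ∑ t ∈ D.toFinset, -Real.logb 2 (W (y t)) ≤ C)
    (M : ℝ) (hM : 2 ≤ M) :
    D.length * Real.logb 2 (D.length / 4) ≤
      C + 2 * D.length * Real.logb 2 M + 4 * S.length / M := by
  let u₁ : List G.Sym → List (Fin σ) := fun t => (t.take 1).flatMap G.expandSym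
  let u₂ : List G.Sym → List (Fin σ) := fun t => (t.drop 1).flatMap G.expandSym
  have hy : ∀ t, u₁ t ++ u₂ t = t.flatMap G.expandSym := fun t => by
    rw [← List.flatMap_append, List.take_append_drop]
  have hTS : T.flatMap (fun t => t.flatMap G.expandSym) = S := by
    rw [← hT, List.flatMap_def, List.flatMap_def, List.map_flatten, List.flatten_flatten,
      List.map_map]
    congr 2
  have hocc : ∀ u, ∑ t ∈ D.toFinset, occurrences u (u₁ t ++ u₂ t) ≤ occurrences u S := by
    intro u
    simp only [hy]
    rw [List.sum_toFinset _ hD, ← hTS]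
    exact ((hDT.map _).sum_le_sum fun _ _ => Nat.zero_le _).trans
      (sum_occurrences_le_flatMap u _ T)
  have hl : ∑ t ∈ D.toFinset, (u₁ t ++ u₂ t).length ≤ S.length := by
    simp only [hy]
    rw [List.sum_toFinset _ hD, ← hTS, List.length_flatMap]
    exact (hDT.map _).sum_le_sum fun _ _ => Nat.zero_le _
  obtain ⟨hpos, hC⟩ := hcost (fun t => u₁ t ++ u₂ t) hocc hl
  -- The bits record which symbols are letters: a nonterminal may expand to a single letter, so
  -- expansions alone need not separate symbols.
  have inj : Set.InjOn (fun t : List G.Sym => (u₁ t, u₂ t,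
      ((t.take 1).any Sum.isLeft, (t.drop 1).any Sum.isLeft))) D.toFinset := by
    intro t ht t' ht' h
    simp only [List.coe_toFinset, Set.mem_ofPred_eq] at ht ht'
    simp only [Prod.mk.injEq, u₁, u₂] at h
    rcases hlen with hlen | hlen
    · obtain ⟨s, rfl⟩ := List.length_eq_one_iff.1 (hlen t ht)
      obtain ⟨s', rfl⟩ := List.length_eq_one_iff.1 (hlen t' ht')
      simp at h
      rw [hG.expandSym_injective h.1 h.2]
    · obtain ⟨p, q, rfl⟩ := List.length_eq_two.1 (hlen t ht)
      obtain ⟨p', q', rfl⟩ := List.length_eq_two.1 (hlen t' ht')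
      simp at h
      rw [hG.expandSym_injective h.1 h.2.2.1, hG.expandSym_injective h.2.1 h.2.2.2]
  have key := card_mul_logb_le_of_weight W hW D.toFinset u₁ u₂ _ inj hpos S.length hl M hM
  rw [List.toFinset_card_of_nodup hD] at key
  linarith

theorem IsIrreducible.card_mul_logb_le_uniform [NeZero σ] {G : FullGrammar σ} {S : List (Fin σ)}
    (hG : G.IsIrreducible) {T D : List (List G.Sym)} (hT : T.flatten.flatMap G.expandSym = S)
    (hDT : D.Sublist T) (hD : D.Nodup)
    (hlen : (∀ t ∈ D, t.length = 1) ∨ ∀ t ∈ D, t.length = 2) (M : ℝ) (hM : 2 ≤ M) :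
    D.length * Real.logb 2 (D.length / 4) ≤
      S.length * Real.logb 2 σ + 2 * D.length * Real.logb 2 M + 4 * S.length / M := by
  have hσ : 1 ≤ σ := NeZero.one_le
  have hσ' : (1 : ℝ) ≤ σ := by exact_mod_cast hσ
  refine hG.card_mul_logb_le hT hDT hD hlen
    (fun y => ((Fintype.card (Fin σ) : ℝ) ^ y.length)⁻¹) sum_uniformWeight_le _ ?_ M hM
  intro y _ hy
  simp only [Fintype.card_fin]
  refine ⟨fun t _ => by positivity, ?_⟩
  simp only [Real.logb_inv, Real.logb_pow, neg_neg]
  rw [← Finset.sum_mul]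
  refine mul_le_mul_of_nonneg_right (by exact_mod_cast hy) (Real.logb_nonneg one_lt_two hσ')

theorem IsIrreducible.card_mul_logb_le_entropy [NeZero σ] {G : FullGrammar σ} {S : List (Fin σ)}
    (hG : G.IsIrreducible) {T D : List (List G.Sym)} (hT : T.flatten.flatMap G.expandSym = S)
    (hDT : D.Sublist T) (hD : D.Nodup)
    (hlen : (∀ t ∈ D, t.length = 1) ∨ ∀ t ∈ D, t.length = 2) (k : ℕ) (hS : S ≠ [])
    (M : ℝ) (hM : 2 ≤ M) :
    D.length * Real.logb 2 (D.length / 4) ≤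
      S.length * empiricalEntropy k S + D.length * (k * Real.logb 2 σ) +
        2 * D.length * Real.logb 2 M + 4 * S.length / M := by
  have hσ : 0 < σ := Nat.pos_of_neZero σ
  refine hG.card_mul_logb_le hT hDT hD hlen
    (fun y => ((Fintype.card (Fin σ) : ℝ) ^ k)⁻¹ * contextWeight (k := k) (empiricalProb S) y)
    (sum_contextWeight_le (empiricalProb_nonneg S) (sum_empiricalProb_le S)) _ ?_ M hM
  intro y hy _
  refine ⟨fun t ht => mul_pos ?_ (contextWeight_pos_of_occurrences_le fun u =>
    (Finset.single_le_sum (f := fun t => occurrences u (y t))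
      (fun _ _ => Nat.zero_le _) ht).trans (hy u)), ?_⟩
  · simp only [Fintype.card_fin]
    positivity
  · have := sum_neg_logb_contextWeight_le k hS hy
    rw [List.toFinset_card_of_nodup hD, Fintype.card_fin] at this
    simpa only [Fintype.card_fin] using this

end FullGrammar

/-! ### Length of the encoding and the asymptotic estimate. -/

namespace FullGrammar

variable {σ : ℕ}

theorem length_fullyNaiveEncoding (G : FullGrammar σ) :
    G.fullyNaiveEncoding.length =
      G.rhs.length + (G.numNonterminals + 1) + G.rhs.length * G.codeLength := by
  have h1 : ∀ L : List (List G.Sym),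
      (L.flatMap fun u => List.replicate u.length true ++ [false]).length =
        L.flatten.length + L.length := by
    intro L
    induction L with
    | nil => rfl
    | cons u L ih =>
      rw [List.flatMap_cons, List.length_append, ih]
      simp
      omega
  have h2 : ∀ l : List G.Sym, (l.flatMap G.symCode).length = l.length * G.codeLength := by
    intro l
    induction l with
    | nil => simp
    | cons s l ih =>
      rw [List.flatMap_cons, List.length_append, ih]
      simp [symCode]
      ring
  rw [fullyNaiveEncoding, List.length_append, h1, h2]
  simp [rhs, rhsList]

theorem codeLength_le (G : FullGrammar σ) {n : ℕ} (hn : 0 < n) (hσ : 0 < σ)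
    (h : σ + G.numNonterminals ≤ 16 * n) : (G.codeLength : ℝ) ≤ Real.logb 2 n + 5 := by
  have hn' : (0 : ℝ) < n := by exact_mod_cast hn
  have hpos : (0 : ℝ) < (σ + G.numNonterminals : ℕ) := by
    exact_mod_cast Nat.add_pos_left hσ _
  have hone : (1 : ℝ) ≤ (σ + G.numNonterminals : ℕ) := by
    exact_mod_cast Nat.add_pos_left hσ _
  have h1 : Real.logb 2 ((σ + G.numNonterminals : ℕ) : ℝ) ≤ Real.logb 2 n + 4 := by
    have h16 : Real.logb 2 16 = 4 := by
      rw [show (16 : ℝ) = 2 ^ (4 : ℕ) by norm_num, Real.logb_pow,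
        Real.logb_self_eq_one one_lt_two]
      norm_num
    calc Real.logb 2 ((σ + G.numNonterminals : ℕ) : ℝ) ≤ Real.logb 2 (16 * n) :=
          Real.logb_le_logb_of_le one_lt_two hpos (by exact_mod_cast h)
      _ = _ := by rw [Real.logb_mul (by norm_num) hn'.ne', h16, add_comm]
  have h2 : ((⌈Real.logb (2 : ℕ) ((σ + G.numNonterminals : ℕ) : ℝ)⌉₊ : ℕ) : ℝ) <
      Real.logb (2 : ℕ) ((σ + G.numNonterminals : ℕ) : ℝ) + 1 :=
    Nat.ceil_lt_add_one (Real.logb_nonneg (by norm_num) hone)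
  rw [Real.natCeil_logb_natCast] at h2
  unfold codeLength
  push_cast at h1 h2 ⊢
  linarith

theorem IsIrreducible.length_fullyNaiveEncoding_le {G : FullGrammar σ} (hG : G.IsIrreducible)
    {n d : ℕ} (hn : 0 < n) (hσ : 0 < σ) (h : σ + G.numNonterminals ≤ 16 * n)
    (hd : G.rhs.length ≤ 6 * d) :
    (G.fullyNaiveEncoding.length : ℝ) ≤ 6 * d * (Real.logb 2 n + 7) + 1 := by
  have hL : 0 ≤ Real.logb 2 n := Real.logb_nonneg one_lt_two (by exact_mod_cast hn)
  have hN : 2 * (G.numNonterminals : ℝ) ≤ G.rhs.length := by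
    exact_mod_cast hG.two_mul_numNonterminals_le
  have hd' : (G.rhs.length : ℝ) ≤ 6 * d := by exact_mod_cast hd
  have h1 := mul_le_mul_of_nonneg_left (G.codeLength_le hn hσ h)
    (Nat.cast_nonneg (α := ℝ) G.rhs.length)
  have h2 := mul_le_mul_of_nonneg_right hd' (by linarith : 0 ≤ Real.logb 2 n + 7)
  rw [length_fullyNaiveEncoding]
  push_cast
  nlinarith

end FullGrammar

theorem exists_logb_growth (ε : ℝ) (hε : 0 < ε) :
    ∃ n₀ : ℕ, ∀ n : ℕ, n₀ ≤ n → 8 ≤ Real.logb 2 n ∧ 1500 / ε ≤ Real.logb 2 n ∧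
      Real.logb 2 (Real.logb 2 n) ≤ 1 / 16 * Real.logb 2 n ∧
      Real.logb 2 (Real.logb 2 n) ≤ ε / 576 * Real.logb 2 n ∧
      6 * (Real.logb 2 n + 7) + 1 ≤ ε * n ∧ 4 ≤ ε * n := by
  have hlog2 : 0 < Real.log 2 := Real.log_pos one_lt_two
  have hsmall : ∀ η : ℝ, 0 < η → ∀ᶠ x : ℝ in Filter.atTop, Real.logb 2 x ≤ η * x := by
    intro η hη
    filter_upwards [Real.isLittleO_log_id_atTop.bound (mul_pos hη hlog2),
      Filter.eventually_ge_atTop 1] with x hx hx1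
    rw [Real.norm_of_nonneg (Real.log_nonneg hx1), id, Real.norm_of_nonneg (by linarith)] at hx
    rw [Real.logb, div_le_iff₀ hlog2]
    linarith
  have hn : Filter.Tendsto (fun n : ℕ => (n : ℝ)) Filter.atTop Filter.atTop :=
    tendsto_natCast_atTop_atTop
  have hL : Filter.Tendsto (fun n : ℕ => Real.logb 2 n) Filter.atTop Filter.atTop :=
    (Real.tendsto_logb_atTop one_lt_two).comp hn
  have hε12 : 0 < ε / 12 := by positivity
  have hε576 : 0 < ε / 576 := by positivity
  obtain ⟨n₀, h⟩ := Filter.eventually_atTop.1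
    ((hL.eventually_ge_atTop 8).and <| (hL.eventually_ge_atTop (1500 / ε)).and <|
      (hL.eventually (hsmall (1 / 16) (by norm_num))).and <|
      (hL.eventually (hsmall _ hε576)).and <|
      (hn.eventually (hsmall _ hε12)).and <| hn.eventually_ge_atTop (86 / ε))
  refine ⟨n₀, fun n hn => ?_⟩
  obtain ⟨h1, h2, h3, h4, h5, h6⟩ := h n hn
  rw [div_le_iff₀ hε] at h6
  exact ⟨h1, h2, h3, h4, by linarith, by linarith⟩

theorem sub_le_logb_div_four {n d L : ℝ} (hn : 0 < n) (hL : 0 < L) (h : n / L ^ 2 ≤ d) :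
    Real.logb 2 n - 2 * Real.logb 2 L - 2 ≤ Real.logb 2 (d / 4) := by
  have h4 : Real.logb 2 4 = 2 := by
    rw [show (4 : ℝ) = 2 ^ (2 : ℕ) by norm_num, Real.logb_pow, Real.logb_self_eq_one one_lt_two]
    norm_num
  calc Real.logb 2 n - 2 * Real.logb 2 L - 2 = Real.logb 2 (n / L ^ 2 / 4) := by
        rw [Real.logb_div (by positivity) (by norm_num),
          Real.logb_div hn.ne' (by positivity), Real.logb_pow, h4]
        norm_num
    _ ≤ _ := Real.logb_le_logb_of_le one_lt_two (by positivity) (by gcongr)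

theorem mainTheorem6 (ε : ℝ) (hε : 0 < ε) :
    ∃ δ : ℝ, 0 < δ ∧ ∃ n₀ : ℕ, ∀ n σ k : ℕ, n₀ ≤ n → 2 ≤ σ → σ ≤ n →
      (k : ℝ) ≤ δ * Real.logb σ n →
      ∀ S : List (Fin σ), S.length = n →
      ∀ G : FullGrammar σ, G.Generates S → G.IsIrreducible →
        (G.fullyNaiveEncoding.length : ℝ) ≤
          6 * (n : ℝ) * empiricalEntropy k S + ε * ((n : ℝ) * Real.logb 2 σ) := by
  obtain ⟨n₀, hn₀⟩ := exists_logb_growth ε hε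
  -- With `d log n ≤ 3 n log σ`, the term `6 d k log σ` is at most `6 · (ε/36) · 3 n log σ`, half of
  -- the error allowed.
  refine ⟨ε / 36, by positivity, n₀, ?_⟩
  intro n σ k hn hσ hσn hk S hSn G hGS hG
  obtain ⟨hL8, hLε, hl16, hlε, hsmall, hε4⟩ := hn₀ n hn
  have hn0 : 0 < n := by omega
  have hσ0 : 0 < σ := by omega
  have : NeZero σ := ⟨hσ0.ne'⟩
  have hn' : (0 : ℝ) < n := by exact_mod_cast hn0
  have hS : S ≠ [] := by
    rintro rfl
    simp at hSn
    omega
  have hH : 0 ≤ (n : ℝ) * empiricalEntropy k S := by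
    rw [← hSn]; exact length_mul_empiricalEntropy_nonneg k S hS
  set L : ℝ := Real.logb 2 n with hLdef
  set l : ℝ := Real.logb 2 L with hldef
  set lam : ℝ := Real.logb 2 σ with hlam
  have hσ' : (2 : ℝ) ≤ σ := by exact_mod_cast hσ
  have hlam1 : 1 ≤ lam := by
    rw [hlam, Real.le_logb_iff_rpow_le one_lt_two (by linarith)]
    simpa using hσ'
  have hlamL : lam ≤ L :=
    Real.logb_le_logb_of_le one_lt_two (by linarith) (by exact_mod_cast hσn)
  have hkL : k * lam ≤ ε / 36 * L := by
    have h1 : Real.logb σ n * lam = L := by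
      have : Real.log σ ≠ 0 := (Real.log_pos (by linarith)).ne'
      rw [hlam, hLdef, Real.logb, Real.logb, Real.logb]
      field_simp
    calc k * lam ≤ ε / 36 * Real.logb σ n * lam := by gcongr
      _ = _ := by rw [mul_assoc, h1]
  have hnl : (n : ℝ) ≤ n * lam := le_mul_of_one_le_right hn'.le hlam1
  have hεnl : ε * n ≤ ε * (n * lam) := by gcongr
  have hN2 := hG.two_mul_numNonterminals_le
  -- A grammar of size below 6 has an encoding of `O(log n)` bits.
  rcases lt_or_ge G.rhs.length 6 with hg | hg
  · have h1 := hG.length_fullyNaiveEncoding_le (n := n) (d := 1) hn0 hσ0 (by omega) (by omega)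
    push_cast at h1
    linarith
  obtain ⟨T, D, hT, hDT, hD, hlen, hgD⟩ := hG.exists_distinct_tokens hGS hg
  set d : ℝ := (D.length : ℝ) with hd
  have hd0 : 0 ≤ d := Nat.cast_nonneg _
  have hL0 : 0 < L := by linarith
  have hnL : (n : ℝ) / L ≤ ε / 1500 * n := by
    rw [div_le_iff₀ hL0]
    rw [div_le_iff₀ hε] at hLε
    nlinarith
  have hEnc : d ≤ 3 * n → (G.fullyNaiveEncoding.length : ℝ) ≤ 6 * d * (L + 7) + 1 := by
    intro hd3
    have hd3' : D.length ≤ 3 * n := by rw [hd] at hd3; exact_mod_cast hd3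
    exact hG.length_fullyNaiveEncoding_le hn0 hσ0 (by omega) hgD
  -- With at most `n / L²` tokens the encoding has `O(n / L)` bits. Otherwise `log d ≥ L - 2 log L`,
  -- so `log d` may replace `log n`.
  rcases le_or_gt d (n / L ^ 2) with hdn | hdn
  · have hdL : d * L ≤ n / L := by
      calc d * L ≤ n / L ^ 2 * L := by gcongr
        _ = n / L := by field_simp
    have hd1 : d ≤ d * L := le_mul_of_one_le_right hd0 (by linarith)
    have hnL1 : (n : ℝ) / L ≤ n := div_le_self hn'.le (by linarith)
    have h1 := hEnc (by linarith)
    nlinarith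
  · have hlog := sub_le_logb_div_four hn' hL0 hdn.le
    have hlow := mul_le_mul_of_nonneg_left hlog hd0
    -- The choice `M = L` makes both `d log M` and `n / M` small.
    have hU := hG.card_mul_logb_le_uniform hT hDT hD hlen L (by linarith)
    have hE := hG.card_mul_logb_le_entropy hT hDT hD hlen k hS L (by linarith)
    rw [hSn] at hU hE
    have h4nL : 4 * (n : ℝ) / L = 4 * (n / L) := by ring
    rw [h4nL] at hU hE
    have hnL8 : (n : ℝ) / L ≤ n / 8 := by gcongr
    have hdl : d * l ≤ d * (1 / 16 * L) := by gcongr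
    have hd8 : d * 8 ≤ d * L := by gcongr
    -- The uniform bound gives `d L ≤ n lam + 4 d l + 2 d + 4 n / L`; here `4 d l` and `2 d` are
    -- each at most `d L / 4`, and `4 n / L ≤ n / 2`.
    have hdL : d * L ≤ 3 * (n * lam) := by nlinarith
    have hd3 : d ≤ 3 * n := by
      have : d * L ≤ 3 * n * L := by
        calc d * L ≤ 3 * (n * lam) := hdL
          _ ≤ 3 * (n * L) := by gcongr
          _ = _ := by ring
      exact le_of_mul_le_mul_right this hL0
    have h1 := hEnc hd3
    have e1 : d * (k * lam) ≤ ε / 36 * (d * L) := by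
      calc d * (k * lam) ≤ d * (ε / 36 * L) := by gcongr
        _ = _ := by ring
    have e2 : d * l ≤ ε / 576 * (d * L) := by
      calc d * l ≤ d * (ε / 576 * L) := by gcongr
        _ = _ := by ring
    have e3 : d ≤ ε / 1500 * (d * L) := by
      rw [div_le_iff₀ hε] at hLε
      nlinarith
    have e4 : ε * (d * L) ≤ ε * (3 * (n * lam)) := by gcongr
    have : d * (L - 2 * l - 2) = d * L - 2 * (d * l) - 2 * d := by ring
    have : 2 * d * l = 2 * (d * l) := by ring
    have : 6 * d * (L + 7) = 6 * (d * L) + 42 * d := by ring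
    -- Error budget in units of `ε n lam`: 1/2 from contexts, 1/8 from `24 d l`, less than 1/8 from
    -- `24 n / L` and `54 d`, and 1/4 from the summand 1.
    linarith
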